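/- Let $\mathbb{U}$ be a real or complex Banach Lie group, that is, a group that is also an analytic manifold modelled on a Banach space, with analytic multiplication and inversion. Let $d$ be a left-invariant or right-invariant metric inducing the topology of $\mathbb{U}$. Let $\mathbb{G}\le\mathbb{U}$ be a Lie subgroup, i.e. a subgroup that is a split submanifold: around each point of $\mathbb{G}$ there is an analytic chart of $\mathbb{U}$ which carries $\mathbb{G}$ to a closed complemented linear subspace of the model space. Let $S\subseteq\mathbb{U}$ be ad-bounded, i.e. $\sup_{g\in S}\|\mathrm{Ad}_g\|<\infty$, where $\mathrm{Ad}$ is the adjoint representation of $\mathbb{U}$ on its Lie algebra. Then for every $\varepsilon>0$ there is a neighborhood $U_0$ of $1$ in $\mathbb{U}$ such that for every compact group $\mathbb{K}$ and every continuous group homomorphism $\varphi:\mathbb{K}\to\mathbb{U}$ with $\varphi(\mathbb{K})\subseteq(\mathbb{G}\cdot U_0)\cap S$ there is a continuous group homomorphism $\psi:\mathbb{K}\to\mathbb{G}$ with $d(\varphi(s),\psi(s))<\varepsilon$ for all $s\in\mathbb{K}$. If moreover $\varphi$ is an embedding (a homeomorphism onto its image), then $\psi$ can also be taken to be an embedding.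 -/

import Mathlib

open scoped Manifold ContDiff Topology Pointwise

namespace BanachLie

section

variable (𝕜 : Type*) [RCLike 𝕜] (E : Type*) [NormedAddCommGroup E] [NormedSpace 𝕜 E]
  {U : Type*} [Group U] [TopologicalSpace U] [ChartedSpace E U]

/-- The adjoint representation of a Lie group `U` modelled on `E`: `Ad g` is the derivative at `1`
of the conjugation `x ↦ g x g⁻¹`. The Lie algebra `T₁U` is carried by the space `E` (through the
preferred chart at `1`). -/
noncomputable def Ad (g : U) : E →L[𝕜] E :=
  mfderiv 𝓘(𝕜, E) 𝓘(𝕜, E) (fun x : U => g * x * g⁻¹) (1 : U)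

/-- `S` is ad-bounded: the operators `Ad g`, `g ∈ S`, are uniformly bounded on the Lie algebra. -/
def AdBounded (S : Set U) : Prop :=
  ∃ C : ℝ, ∀ g ∈ S, ‖Ad 𝕜 E g‖ ≤ C

/-- `G` is a Lie subgroup of `U`: a subgroup that is a (split, embedded) analytic submanifold, i.e.
around each of its points there is an analytic chart `χ` of `U` which carries `G` to a closed
subspace `F` of `E` having a closed complement. -/
def IsLieSubgroup (G : Subgroup U) : Prop :=
  ∀ g ∈ G, ∃ χ ∈ IsManifold.maximalAtlas 𝓘(𝕜, E) ω U, g ∈ χ.source ∧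
    ∃ F : Submodule 𝕜 E, F.ClosedComplemented ∧ ∀ x ∈ χ.source, x ∈ G ↔ χ x ∈ F

end

end BanachLie

/-! The image `H` of `φ` is a compact subgroup acting on `U / G` by left translation, and each of
its elements moves the base coset only little. A fixed coset `xG` with `x` near `1` gives `x⁻¹ H x ⊆
G`, so `ψ = x⁻¹ φ x` takes values in `G`; it is uniformly close to `φ` because conjugations by
elements of `S` are equicontinuous at `1`.

To find the fixed coset, `U / G` is modelled near the base point by a slice
(`IsIdentityChart.exists_slice`), on which `H` acts locally by maps `α h`. Ad-boundedness gives
these maps first and second order bounds that do not depend on `h` or on `H`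
(`IsIdentityChart.exists_conj_quadApprox`). The Haar mean of an orbit would be fixed if the action
were affine; here its displacement is quadratic in the displacement of the starting point
(`exists_displacement_le`). As in Newton's method, iteration converges to a fixed point
(`exists_fixed_point`), and the smallness required depends only on the uniform constants.
`IsIdentityChart.exists_conj_mem` assembles these facts. -/

namespace BanachLie

/-- A chart `κ` at the identity of a topological group, centred at `0`, in which multiplication and
left division are twice continuously differentiable near the identity. -/
structure IsIdentityChart (𝕜 : Type*) [RCLike 𝕜] {E : Type*} [NormedAddCommGroup E]
    [NormedSpace 𝕜 E] {U : Type*} [Group U] [TopologicalSpace U]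
    (κ : OpenPartialHomeomorph U E) : Prop where
  one_mem : (1 : U) ∈ κ.source
  map_one : κ 1 = 0
  mul : ContDiffAt 𝕜 2 (fun p : E × E => κ (κ.symm p.1 * κ.symm p.2)) (0, 0)
  div : ContDiffAt 𝕜 2 (fun p : E × E => κ ((κ.symm p.1)⁻¹ * κ.symm p.2)) (0, 0)

/-! ### Centred charts at the identity adapted to a Lie subgroup. -/

section Manifold

variable {𝕜 : Type*} [RCLike 𝕜] {E : Type*} [NormedAddCommGroup E] [NormedSpace 𝕜 E]
  {U : Type*} [TopologicalSpace U] [ChartedSpace E U]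

theorem contMDiffAt_transHomeomorph_addRight {χ : OpenPartialHomeomorph U E}
    (hχ : χ ∈ IsManifold.maximalAtlas 𝓘(𝕜, E) ω U) (a : E) {x : U} (hx : x ∈ χ.source) :
    ContMDiffAt 𝓘(𝕜, E) 𝓘(𝕜, E) ω (χ.transHomeomorph (Homeomorph.addRight a)) x := by
  have h1 : ContMDiffAt 𝓘(𝕜, E) 𝓘(𝕜, E) ω χ x :=
    (contMDiffOn_of_mem_maximalAtlas hχ).contMDiffAt (χ.open_source.mem_nhds hx)
  have h2 : ContMDiffAt 𝓘(𝕜, E) 𝓘(𝕜, E) ω (fun y : E => y + a) (χ x) :=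
    (contDiff_id.add contDiff_const).contMDiff.contMDiffAt
  exact h2.comp x h1

theorem contMDiffAt_transHomeomorph_addRight_symm {χ : OpenPartialHomeomorph U E}
    (hχ : χ ∈ IsManifold.maximalAtlas 𝓘(𝕜, E) ω U) (a : E) {y : E} (hy : y - a ∈ χ.target) :
    ContMDiffAt 𝓘(𝕜, E) 𝓘(𝕜, E) ω (χ.transHomeomorph (Homeomorph.addRight a)).symm y := by
  have h1 : ContMDiffAt 𝓘(𝕜, E) 𝓘(𝕜, E) ω χ.symm (y - a) :=
    (contMDiffOn_symm_of_mem_maximalAtlas hχ).contMDiffAt (χ.open_target.mem_nhds hy)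
  have h2 : ContMDiffAt 𝓘(𝕜, E) 𝓘(𝕜, E) ω (fun y : E => y - a) y :=
    (contDiff_id.sub contDiff_const).contMDiff.contMDiffAt
  have := ContMDiffAt.comp (g := χ.symm) (f := fun y : E => y - a) y h1 h2
  refine this.congr_of_eventuallyEq (Filter.Eventually.of_forall fun z => ?_)
  simp only [Function.comp_apply, sub_eq_add_neg]
  rfl

variable [Group U] [LieGroup 𝓘(𝕜, E) ω U]

theorem isIdentityChart_of_contMDiffAt {κ : OpenPartialHomeomorph U E}
    (h1 : (1 : U) ∈ κ.source) (h0 : κ 1 = 0)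
    (hκ : ContMDiffAt 𝓘(𝕜, E) 𝓘(𝕜, E) ω κ 1)
    (hκs : ContMDiffAt 𝓘(𝕜, E) 𝓘(𝕜, E) ω κ.symm 0) : IsIdentityChart 𝕜 κ := by
  have hs : κ.symm 0 = 1 := by rw [← h0, κ.left_inv h1]
  have hfst : ContMDiffAt 𝓘(𝕜, E × E) 𝓘(𝕜, E) ω (fun p : E × E => κ.symm p.1) (0, 0) :=
    ContMDiffAt.comp (g := κ.symm) (f := Prod.fst) ((0 : E), (0 : E)) hκs
      contDiff_fst.contMDiff.contMDiffAt
  have hsnd : ContMDiffAt 𝓘(𝕜, E × E) 𝓘(𝕜, E) ω (fun p : E × E => κ.symm p.2) (0, 0) :=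
    ContMDiffAt.comp (g := κ.symm) (f := Prod.snd) ((0 : E), (0 : E)) hκs
      contDiff_snd.contMDiff.contMDiffAt
  refine ⟨h1, h0, ?_, ?_⟩
  · have h : ContMDiffAt 𝓘(𝕜, E × E) 𝓘(𝕜, E) ω
        (fun p : E × E => κ.symm p.1 * κ.symm p.2) (0, 0) := hfst.mul hsnd
    have h' := ContMDiffAt.comp (g := κ) (0, 0) (by simpa [hs] using hκ) h
    exact (contMDiffAt_iff_contDiffAt.1 h').of_le le_top
  · have h : ContMDiffAt 𝓘(𝕜, E × E) 𝓘(𝕜, E) ω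
        (fun p : E × E => (κ.symm p.1)⁻¹ * κ.symm p.2) (0, 0) := hfst.inv.mul hsnd
    have h' := ContMDiffAt.comp (g := κ) (0, 0) (by simpa [hs] using hκ) h
    exact (contMDiffAt_iff_contDiffAt.1 h').of_le le_top

/-- In a chart at the identity, the derivative of conjugation is controlled by `‖Ad g‖`. -/
theorem exists_hasFDerivAt_conj {κ : OpenPartialHomeomorph U E}
    (h1 : (1 : U) ∈ κ.source) (h0 : κ 1 = 0)
    (hκ : ContMDiffAt 𝓘(𝕜, E) 𝓘(𝕜, E) ω κ 1)
    (hκs : ContMDiffAt 𝓘(𝕜, E) 𝓘(𝕜, E) ω κ.symm 0) :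
    ∃ M : ℝ, 0 ≤ M ∧ ∀ g : U, ∃ D : E →L[𝕜] E, ‖D‖ ≤ M * ‖Ad 𝕜 E g‖ ∧
      HasFDerivAt (fun y : E => κ (g * κ.symm y * g⁻¹)) D 0 := by
  have hs : κ.symm 0 = 1 := by rw [← h0, κ.left_inv h1]
  let D₁ : E →L[𝕜] E := mfderiv 𝓘(𝕜, E) 𝓘(𝕜, E) κ 1
  let D₂ : E →L[𝕜] E := mfderiv 𝓘(𝕜, E) 𝓘(𝕜, E) κ.symm 0
  refine ⟨‖D₁‖ * ‖D₂‖, by positivity, fun g => ⟨D₁ ∘L Ad 𝕜 E g ∘L D₂, ?_, ?_⟩⟩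
  · calc ‖D₁ ∘L Ad 𝕜 E g ∘L D₂‖ ≤ ‖D₁‖ * (‖Ad 𝕜 E g‖ * ‖D₂‖) :=
          (ContinuousLinearMap.opNorm_comp_le _ _).trans
            (mul_le_mul_of_nonneg_left (ContinuousLinearMap.opNorm_comp_le _ _) (norm_nonneg _))
      _ = ‖D₁‖ * ‖D₂‖ * ‖Ad 𝕜 E g‖ := by ring
  · have e1 : HasMFDerivAt 𝓘(𝕜, E) 𝓘(𝕜, E) κ 1 D₁ :=
      (hκ.mdifferentiableAt (by simp)).hasMFDerivAt
    have e2 : HasMFDerivAt 𝓘(𝕜, E) 𝓘(𝕜, E) κ.symm 0 D₂ :=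
      (hκs.mdifferentiableAt (by simp)).hasMFDerivAt
    have hc : ContMDiff 𝓘(𝕜, E) 𝓘(𝕜, E) ω (fun x : U => g * x * g⁻¹) :=
      (contMDiff_const.mul contMDiff_id).mul contMDiff_const
    have e3 : HasMFDerivAt 𝓘(𝕜, E) 𝓘(𝕜, E) (fun x : U => g * x * g⁻¹) 1 (Ad 𝕜 E g) :=
      ((hc 1).mdifferentiableAt (by simp)).hasMFDerivAt
    have e4 : HasMFDerivAt 𝓘(𝕜, E) 𝓘(𝕜, E) (fun y : E => g * κ.symm y * g⁻¹) 0
        (Ad 𝕜 E g ∘L D₂) :=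
      HasMFDerivAt.comp (g := fun x : U => g * x * g⁻¹) (f := κ.symm) 0 (by rw [hs]; exact e3) e2
    have e5 : HasMFDerivAt 𝓘(𝕜, E) 𝓘(𝕜, E) (fun y : E => κ (g * κ.symm y * g⁻¹)) 0
        (D₁ ∘L Ad 𝕜 E g ∘L D₂) := by
      refine HasMFDerivAt.comp (g := κ) (f := fun y : E => g * κ.symm y * g⁻¹) 0 ?_ e4
      have : g * κ.symm 0 * g⁻¹ = 1 := by simp [hs]
      rw [this]; exact e1
    exact hasMFDerivAt_iff_hasFDerivAt.1 e5

/-- A Lie subgroup is, near the identity, the kernel of a continuous linear projection in a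
suitable centred chart. -/
theorem IsLieSubgroup.exists_chart {G : Subgroup U} (hG : IsLieSubgroup 𝕜 E G) :
    ∃ κ : OpenPartialHomeomorph U E, IsIdentityChart 𝕜 κ ∧
      (∃ π : E →L[𝕜] E, (∀ v, π (π v) = π v) ∧ ∀ x ∈ κ.source, x ∈ G ↔ π (κ x) = 0) ∧
      ∃ M : ℝ, 0 ≤ M ∧ ∀ g : U, ∃ D : E →L[𝕜] E, ‖D‖ ≤ M * ‖Ad 𝕜 E g‖ ∧
        HasFDerivAt (fun y : E => κ (g * κ.symm y * g⁻¹)) D 0 := by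
  obtain ⟨χ, hχ, h1, F, ⟨P, hP⟩, hF⟩ := hG 1 G.one_mem
  -- Since `χ 1` lies in `F`, translating the chart by `-χ 1` keeps the image of `G` inside `F`; the
  -- projection sought is then `id - P`, whose kernel is `F`.
  have h1F : χ 1 ∈ F := (hF 1 h1).1 G.one_mem
  let κ := χ.transHomeomorph (Homeomorph.addRight (-χ 1))
  have hκv : ∀ x, κ x = χ x - χ 1 := fun x => by simp [κ, sub_eq_add_neg]
  have h1' : (1 : U) ∈ κ.source := h1
  have h0 : κ 1 = 0 := by simp [hκv]
  have hκ := contMDiffAt_transHomeomorph_addRight hχ (-χ 1) h1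
  have hκs := contMDiffAt_transHomeomorph_addRight_symm hχ (-χ 1) (y := 0)
    (by simpa using χ.map_source h1)
  refine ⟨κ, isIdentityChart_of_contMDiffAt h1' h0 hκ hκs,
    ⟨ContinuousLinearMap.id 𝕜 E - F.subtypeL ∘L P, fun v => ?_, fun x hx => ?_⟩,
    exists_hasFDerivAt_conj h1' h0 hκ hκs⟩
  · have := hP (P v)
    simp [this]
  · have key : ∀ y : E, (ContinuousLinearMap.id 𝕜 E - F.subtypeL ∘L P) y = 0 ↔ y ∈ F := by
      intro y
      simp only [sub_apply, ContinuousLinearMap.id_apply,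
        ContinuousLinearMap.comp_apply, Submodule.subtypeL_apply, sub_eq_zero]
      constructor
      · intro h; rw [h]; exact (P y).2
      · intro h; rw [hP ⟨y, h⟩]
    rw [key, hκv, hF x hx, F.sub_mem_iff_left h1F]

end Manifold

/-! ### First order approximation with uniform quadratic error. -/

section QuadApprox

variable {𝕜 : Type*} [RCLike 𝕜] {X Y Z : Type*} [NormedAddCommGroup X] [NormedSpace 𝕜 X]
  [NormedAddCommGroup Y] [NormedSpace 𝕜 Y] [NormedAddCommGroup Z] [NormedSpace 𝕜 Z]

variable (𝕜) in
/-- `f` has at each point of `B` an affine approximation with quadratic error, with all constants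
bounded by `C`. -/
def QuadApprox (f : X → Y) (B : Set X) (C : ℝ) : Prop :=
  ∀ v ∈ B, ∃ D : X →L[𝕜] Y, ‖D‖ ≤ C ∧ ∀ y ∈ B, ‖f y - f v - D (y - v)‖ ≤ C * ‖y - v‖ ^ 2

theorem QuadApprox.mono {f : X → Y} {A B : Set X} {C C' : ℝ} (h : QuadApprox 𝕜 f B C)
    (hAB : A ⊆ B) (hC : C ≤ C') : QuadApprox 𝕜 f A C' := by
  intro v hv
  obtain ⟨D, hD, h⟩ := h v (hAB hv)
  exact ⟨D, hD.trans hC, fun y hy => (h y (hAB hy)).trans (by gcongr)⟩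

theorem QuadApprox.norm_sub_le {f : X → Y} {B : Set X} {C : ℝ} (h : QuadApprox 𝕜 f B C)
    {x y : X} (hx : x ∈ B) (hy : y ∈ B) : ‖f y - f x‖ ≤ C * (1 + ‖y - x‖) * ‖y - x‖ := by
  obtain ⟨D, hD, h⟩ := h x hx
  calc ‖f y - f x‖ = ‖(f y - f x - D (y - x)) + D (y - x)‖ := by congr 1; abel
    _ ≤ C * ‖y - x‖ ^ 2 + C * ‖y - x‖ :=
        (norm_add_le _ _).trans (add_le_add (h y hy) (D.le_of_opNorm_le hD _))
    _ = _ := by ring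

/-- The error of `f` passes through the linear part of `g`, while the error of `g` is quadratic in
`‖f y - f v‖`. The Lipschitz bound for `f` controls the latter, and needs the diameter bound `d`. -/
theorem QuadApprox.comp {f : X → Y} {g : Y → Z} {B : Set X} {B' : Set Y} {C C' d : ℝ}
    (hC : 0 ≤ C) (hC' : 0 ≤ C')
    (hg : QuadApprox 𝕜 g B' C') (hf : QuadApprox 𝕜 f B C) (hfB : Set.MapsTo f B B')
    (hd : ∀ x ∈ B, ∀ y ∈ B, ‖y - x‖ ≤ d) :
    QuadApprox 𝕜 (fun x => g (f x)) B (C' * (C * (1 + d)) ^ 2 + C' * C) := by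
  intro v hv
  obtain ⟨D, hD, hDf⟩ := hf v hv
  obtain ⟨D', hD', hDg⟩ := hg (f v) (hfB hv)
  refine ⟨D' ∘L D, ?_, fun y hy => ?_⟩
  · have h1 : ‖D' ∘L D‖ ≤ C' * C := (ContinuousLinearMap.opNorm_comp_le _ _).trans (by gcongr)
    have h2 : 0 ≤ C' * (C * (1 + d)) ^ 2 := by positivity
    linarith
  · have h1 : ‖f y - f v‖ ≤ C * (1 + d) * ‖y - v‖ :=
      (hf.norm_sub_le hv hy).trans (by gcongr; exact hd v hv y hy)
    calc ‖g (f y) - g (f v) - (D' ∘L D) (y - v)‖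
        = ‖(g (f y) - g (f v) - D' (f y - f v)) + D' (f y - f v - D (y - v))‖ := by
          congr 1; simp only [ContinuousLinearMap.comp_apply, map_sub]; abel
      _ ≤ C' * ‖f y - f v‖ ^ 2 + C' * (C * ‖y - v‖ ^ 2) :=
          (norm_add_le _ _).trans (add_le_add (hDg _ (hfB hy))
            ((D'.le_of_opNorm_le hD' _).trans (by gcongr; exact hDf y hy)))
      _ ≤ C' * (C * (1 + d) * ‖y - v‖) ^ 2 + C' * (C * ‖y - v‖ ^ 2) := by gcongr
      _ = _ := by ring

theorem ContinuousLinearMap.quadApprox (L : X →L[𝕜] Y) (B : Set X) : QuadApprox 𝕜 L B ‖L‖ :=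
  fun v _ => ⟨L, le_rfl, fun y _ => by simp only [← map_sub, sub_self, norm_zero]; positivity⟩

/-- A map with Lipschitz bounded derivative on a convex set is quadratically approximated. -/
theorem quadApprox_of_hasFDerivAt {f : X → Y} {f' : X → X →L[𝕜] Y} {a : X} {r C : ℝ}
    (hf : ∀ x ∈ Metric.ball a r, HasFDerivAt f (f' x) x)
    (hC : ∀ x ∈ Metric.ball a r, ‖f' x‖ ≤ C)
    (hL : ∀ x ∈ Metric.ball a r, ∀ y ∈ Metric.ball a r, ‖f' y - f' x‖ ≤ C * ‖y - x‖) :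
    QuadApprox 𝕜 f (Metric.ball a r) C := by
  let _ : NormedSpace ℝ X := NormedSpace.restrictScalars ℝ 𝕜 X
  intro v hv
  refine ⟨f' v, hC v hv, fun y hy => ?_⟩
  have hC0 : 0 ≤ C := (norm_nonneg _).trans (hC v hv)
  have hseg : segment ℝ v y ⊆ Metric.ball a r := (convex_ball a r).segment_subset hv hy
  have := Convex.norm_image_sub_le_of_norm_hasFDerivWithin_le' (𝕜 := 𝕜) (f := f) (f' := f')
    (C := C * ‖y - v‖) (s := segment ℝ v y) (x := v) (y := y) (φ := f' v)
    (fun x hx => (hf x (hseg hx)).hasFDerivWithinAt)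
    (fun x hx => (hL v hv x (hseg hx)).trans (by
      gcongr
      have := norm_sub_le_of_mem_segment hx
      rwa [norm_sub_rev y v, norm_sub_rev x v] at *))
    (convex_segment v y) (left_mem_segment ℝ v y) (right_mem_segment ℝ v y)
  calc _ ≤ C * ‖y - v‖ * ‖y - v‖ := this
    _ = _ := by ring

/-- The derivative of a `C²` map is `C¹`, hence locally bounded and locally Lipschitz. -/
theorem exists_ball_of_contDiffAt {f : X → Y} {a : X} (hf : ContDiffAt 𝕜 2 f a) :
    ∃ r > 0, ∃ C ≥ 0, (∀ x ∈ Metric.ball a r, ContDiffAt 𝕜 2 f x) ∧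
      (∀ x ∈ Metric.ball a r, ‖fderiv 𝕜 f x‖ ≤ C) ∧
      ∀ x ∈ Metric.ball a r, ∀ y ∈ Metric.ball a r,
        ‖fderiv 𝕜 f y - fderiv 𝕜 f x‖ ≤ C * ‖y - x‖ := by
  have h1 : ContDiffAt 𝕜 1 (fderiv 𝕜 f) a := hf.fderiv_right (by norm_num)
  obtain ⟨K, t, ht, hK⟩ := h1.exists_lipschitzOnWith
  have h2 : ∀ᶠ x in 𝓝 a, ‖fderiv 𝕜 f x‖ < ‖fderiv 𝕜 f a‖ + 1 :=
    h1.continuousAt.norm.eventually_lt_const (by linarith)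
  obtain ⟨r, hr, h⟩ := Metric.eventually_nhds_iff_ball.1
    ((hf.eventually (by simp)).and (h2.and ht))
  refine ⟨r, hr, max K (‖fderiv 𝕜 f a‖ + 1), le_max_of_le_left K.2, fun x hx => (h x hx).1,
    fun x hx => (h x hx).2.1.le.trans (le_max_right _ _), fun x hx y hy => ?_⟩
  calc _ ≤ K * ‖y - x‖ := hK.norm_sub_le (h y hy).2.2 (h x hx).2.2
    _ ≤ _ := by gcongr; exact le_max_left _ _

theorem exists_quadApprox_of_contDiffAt {f : X → Y} {a : X} (hf : ContDiffAt 𝕜 2 f a) :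
    ∃ r > 0, ∃ C ≥ 0, QuadApprox 𝕜 f (Metric.ball a r) C := by
  obtain ⟨r, hr, C, hC, h1, h2, h3⟩ := exists_ball_of_contDiffAt hf
  exact ⟨r, hr, C, hC, quadApprox_of_hasFDerivAt
    (fun x hx => ((h1 x hx).differentiableAt (by simp)).hasFDerivAt) h2 h3⟩

end QuadApprox

/-! ### Uniform control of conjugations near the identity. -/

section Conj

variable {𝕜 : Type*} [RCLike 𝕜] {E : Type*} [NormedAddCommGroup E] [NormedSpace 𝕜 E]
  {U : Type*} [Group U] [TopologicalSpace U] {κ : OpenPartialHomeomorph U E}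

theorem IsIdentityChart.zero_mem (hκ : IsIdentityChart 𝕜 κ) : (0 : E) ∈ κ.target := by
  rw [← hκ.map_one]; exact κ.map_source hκ.one_mem

theorem IsIdentityChart.symm_zero (hκ : IsIdentityChart 𝕜 κ) : κ.symm 0 = 1 := by
  rw [← hκ.map_one, κ.left_inv hκ.one_mem]

theorem IsIdentityChart.continuousAt_symm (hκ : IsIdentityChart 𝕜 κ) :
    ContinuousAt κ.symm 0 :=
  κ.symm.continuousAt hκ.zero_mem

variable [IsTopologicalGroup U]

/-- The derivative of conjugation in a chart, at a point near the identity, computed from the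
derivative at the identity by translation. -/
theorem IsIdentityChart.hasFDerivAt_conj (hκ : IsIdentityChart 𝕜 κ) {g : U} {D : E →L[𝕜] E}
    (hD : HasFDerivAt (fun y : E => κ (g * κ.symm y * g⁻¹)) D 0) {x : E} (hx : x ∈ κ.target)
    (hgx : g * κ.symm x * g⁻¹ ∈ κ.source)
    (hm : DifferentiableAt 𝕜 (fun p : E × E => κ (κ.symm p.1 * κ.symm p.2))
      (κ (g * κ.symm x * g⁻¹), 0))
    (hn : DifferentiableAt 𝕜 (fun p : E × E => κ ((κ.symm p.1)⁻¹ * κ.symm p.2)) (x, x)) :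
    HasFDerivAt (fun y : E => κ (g * κ.symm y * g⁻¹))
      ((fderiv 𝕜 (fun p : E × E => κ (κ.symm p.1 * κ.symm p.2)) (κ (g * κ.symm x * g⁻¹), 0) ∘L
        ContinuousLinearMap.inr 𝕜 E E) ∘L D ∘L
        (fderiv 𝕜 (fun p : E × E => κ ((κ.symm p.1)⁻¹ * κ.symm p.2)) (x, x) ∘L
        ContinuousLinearMap.inr 𝕜 E E)) x := by
  -- With `c` denoting conjugation by `g` in the chart, the identity `g y g⁻¹ = (g x g⁻¹) · g (x⁻¹
  -- y) g⁻¹` reads `c y = m (c x, c (n (x, y)))` for `y` near `x`; as `n (x, x) = 0`, only the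
  -- derivative of `c` at `0` enters the chain rule.
  set m := fun p : E × E => κ (κ.symm p.1 * κ.symm p.2) with hm_def
  set n := fun p : E × E => κ ((κ.symm p.1)⁻¹ * κ.symm p.2) with hn_def
  set z := κ (g * κ.symm x * g⁻¹) with hz
  have hnx : n (x, x) = 0 := by simp [hn_def, hκ.map_one]
  have h1 : HasFDerivAt (fun y => n (x, y)) (fderiv 𝕜 n (x, x) ∘L
      ContinuousLinearMap.inr 𝕜 E E) x :=
    HasFDerivAt.comp x hn.hasFDerivAt (hasFDerivAt_prodMk_right x x)
  have h2 : HasFDerivAt (fun y => m (z, y)) (fderiv 𝕜 m (z, 0) ∘L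
      ContinuousLinearMap.inr 𝕜 E E) 0 :=
    HasFDerivAt.comp 0 hm.hasFDerivAt (hasFDerivAt_prodMk_right z 0)
  have h3 := HasFDerivAt.comp x (g := fun y : E => κ (g * κ.symm y * g⁻¹))
    (f := fun y => n (x, y)) (by simpa only [hnx] using hD) h1
  have h4 := HasFDerivAt.comp x (g := fun y => m (z, y))
    (f := (fun y : E => κ (g * κ.symm y * g⁻¹)) ∘ fun y => n (x, y))
    (by simpa only [Function.comp_apply, hnx, hκ.symm_zero, mul_one, mul_inv_cancel, hκ.map_one]
      using h2) h3
  refine h4.congr_of_eventuallyEq ?_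
  have hc : ContinuousAt (fun y => (κ.symm x)⁻¹ * κ.symm y) x :=
    continuousAt_const.mul (κ.symm.continuousAt hx)
  have hc' : ContinuousAt (fun y => g * ((κ.symm x)⁻¹ * κ.symm y) * g⁻¹) x :=
    (continuousAt_const.mul hc).mul continuousAt_const
  have e1 : ∀ᶠ y in 𝓝 x, (κ.symm x)⁻¹ * κ.symm y ∈ κ.source :=
    hc.eventually (κ.open_source.mem_nhds (by simpa using hκ.one_mem))
  have e2 : ∀ᶠ y in 𝓝 x, g * ((κ.symm x)⁻¹ * κ.symm y) * g⁻¹ ∈ κ.source :=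
    hc'.eventually (κ.open_source.mem_nhds (by simpa using hκ.one_mem))
  filter_upwards [e1, e2] with y hy1 hy2
  simp only [Function.comp_apply, hm_def, hn_def, hz]
  rw [κ.left_inv hy1, κ.left_inv hy2, κ.left_inv hgx]
  congr 1
  group

/-- A uniform bound for the derivative at the identity of conjugations yields uniform
first and second order control on a uniform neighbourhood of the identity. -/
theorem IsIdentityChart.exists_conj_quadApprox (hκ : IsIdentityChart 𝕜 κ) {A : ℝ} (hA : 0 ≤ A) :
    ∃ r > 0, ∃ L ≥ 0, Metric.ball 0 r ⊆ κ.target ∧ ∀ g : U, ∀ D : E →L[𝕜] E, ‖D‖ ≤ A →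
      HasFDerivAt (fun y : E => κ (g * κ.symm y * g⁻¹)) D 0 →
      (∀ y ∈ Metric.ball (0 : E) r, g * κ.symm y * g⁻¹ ∈ κ.source) ∧
      (∀ y ∈ Metric.ball (0 : E) r, ‖κ (g * κ.symm y * g⁻¹)‖ ≤ L * ‖y‖) ∧
      QuadApprox 𝕜 (fun y : E => κ (g * κ.symm y * g⁻¹)) (Metric.ball 0 r) L := by
  let _ : NormedSpace ℝ E := NormedSpace.restrictScalars ℝ 𝕜 E
  obtain ⟨r₁, hr₁, C₁, hC₁, hm1, hm2, hm3⟩ := exists_ball_of_contDiffAt hκ.mul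
  obtain ⟨r₂, hr₂, C₂, hC₂, hn1, hn2, hn3⟩ := exists_ball_of_contDiffAt hκ.div
  set m := fun p : E × E => κ (κ.symm p.1 * κ.symm p.2) with hm_def
  set n := fun p : E × E => κ ((κ.symm p.1)⁻¹ * κ.symm p.2) with hn_def
  -- A closed neighbourhood inside the source keeps limits of points of `N` in the domain of `κ`.
  obtain ⟨N, hN, hNc, hNs⟩ := exists_mem_nhds_isClosed_subset (κ.open_source.mem_nhds hκ.one_mem)
  have hev : ∀ᶠ y in 𝓝 (0 : E), y ∈ κ.target ∧ κ.symm y ∈ N :=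
    Filter.Eventually.and (κ.open_target.mem_nhds hκ.zero_mem)
      (hκ.continuousAt_symm.eventually (by rw [hκ.symm_zero]; exact hN))
  obtain ⟨R₀, hR₀, hR⟩ := Metric.eventually_nhds_iff_ball.1 hev
  set R := min R₀ r₁ with hR_def
  have hRpos : 0 < R := lt_min hR₀ hr₁
  set L₀ := C₁ * (A * C₂) with hL₀_def
  have hL₀ : 0 ≤ L₀ := by positivity
  set r := min r₂ (min R (R / (2 * (L₀ + 1)))) with hr_def
  have hr : 0 < r := by positivity
  have hrR : r ≤ R := (min_le_right _ _).trans (min_le_left _ _)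
  have hLr : L₀ * r ≤ R / 2 := by
    have : r ≤ R / (2 * (L₀ + 1)) := (min_le_right _ _).trans (min_le_right _ _)
    rw [le_div_iff₀ (by positivity)] at this
    nlinarith
  have hball : Metric.ball (0 : E) r ⊆ κ.target := fun y hy =>
    (hR y (Metric.ball_subset_ball (hrR.trans (min_le_left _ _)) hy)).1
  -- `L₀` bounds the derivative of a conjugation and `L₀ * L₀ + L₀` is a Lipschitz constant for that
  -- derivative, from the product rule at the end.
  refine ⟨r, hr, L₀ * L₀ + L₀, by positivity, hball, fun g D hDA hD => ?_⟩
  set c := fun y : E => κ (g * κ.symm y * g⁻¹) with hc_def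
  have hc0 : c 0 = 0 := by simp [hc_def, hκ.symm_zero, hκ.map_one]
  set V := κ.source ∩ κ ⁻¹' Metric.ball 0 R with hV_def
  have hVo : IsOpen V := κ.isOpen_inter_preimage Metric.isOpen_ball
  let P : E → E →L[𝕜] E := fun z => fderiv 𝕜 m (z, 0) ∘L ContinuousLinearMap.inr 𝕜 E E
  let Q : E → E →L[𝕜] E := fun x => fderiv 𝕜 n (x, x) ∘L ContinuousLinearMap.inr 𝕜 E E
  have hinr : ‖ContinuousLinearMap.inr 𝕜 E E‖ ≤ 1 := ContinuousLinearMap.norm_inr_le_one 𝕜 E E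
  have mem1 : ∀ z ∈ Metric.ball (0 : E) R, ((z, 0) : E × E) ∈ Metric.ball ((0 : E), (0 : E)) r₁ :=
    fun z hz => by
      rw [← ball_prod_same]
      exact ⟨Metric.ball_subset_ball (min_le_right _ _) hz, Metric.mem_ball_self hr₁⟩
  have mem2 : ∀ z ∈ Metric.ball (0 : E) r, ((z, z) : E × E) ∈ Metric.ball ((0 : E), (0 : E)) r₂ :=
    fun z hz => by
      rw [← ball_prod_same]
      exact ⟨Metric.ball_subset_ball (min_le_left _ _) hz,
        Metric.ball_subset_ball (min_le_left _ _) hz⟩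
  have comp_inr : ∀ (T : E × E →L[𝕜] E) (b : ℝ), ‖T‖ ≤ b →
      ‖T ∘L ContinuousLinearMap.inr 𝕜 E E‖ ≤ b := fun T b hT =>
    (ContinuousLinearMap.opNorm_comp_le _ _).trans
      ((mul_le_of_le_one_right (norm_nonneg _) hinr).trans hT)
  have hP : ∀ z ∈ Metric.ball (0 : E) R, ‖P z‖ ≤ C₁ := fun z hz => comp_inr _ _ (hm2 _ (mem1 z hz))
  have hQ : ∀ z ∈ Metric.ball (0 : E) r, ‖Q z‖ ≤ C₂ := fun z hz => comp_inr _ _ (hn2 _ (mem2 z hz))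
  have hPL : ∀ z ∈ Metric.ball (0 : E) R, ∀ w ∈ Metric.ball (0 : E) R,
      ‖P w - P z‖ ≤ C₁ * ‖w - z‖ := fun z hz w hw => by
    have := hm3 _ (mem1 z hz) _ (mem1 w hw)
    simp only [P, ← ContinuousLinearMap.sub_comp]
    refine comp_inr _ _ (this.trans_eq ?_)
    simp [Prod.norm_def]
  have hQL : ∀ z ∈ Metric.ball (0 : E) r, ∀ w ∈ Metric.ball (0 : E) r,
      ‖Q w - Q z‖ ≤ C₂ * ‖w - z‖ := fun z hz w hw => by
    have := hn3 _ (mem2 z hz) _ (mem2 w hw)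
    simp only [Q, ← ContinuousLinearMap.sub_comp]
    refine comp_inr _ _ (this.trans_eq ?_)
    simp [Prod.norm_def]
  have triple : ∀ (S T W : E →L[𝕜] E) (s t w : ℝ), 0 ≤ s → 0 ≤ t → ‖S‖ ≤ s → ‖T‖ ≤ t → ‖W‖ ≤ w →
      ‖S ∘L T ∘L W‖ ≤ s * (t * w) := fun S T W s t w hs ht hS hT hW =>
    (ContinuousLinearMap.opNorm_comp_le _ _).trans (mul_le_mul hS
      ((ContinuousLinearMap.opNorm_comp_le _ _).trans (by gcongr)) (norm_nonneg _) hs)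
  have hder : ∀ x ∈ Metric.ball (0 : E) r, g * κ.symm x * g⁻¹ ∈ V →
      HasFDerivAt c (P (c x) ∘L D ∘L Q x) x ∧ ‖P (c x) ∘L D ∘L Q x‖ ≤ L₀ := fun x hx hxV =>
    ⟨hκ.hasFDerivAt_conj hD (hball hx) hxV.1
      ((hm1 _ (mem1 _ hxV.2)).differentiableAt (by simp))
      ((hn1 _ (mem2 _ hx)).differentiableAt (by simp)),
      triple _ _ _ _ _ _ hC₁ hA (hP _ hxV.2) hDA (hQ x hx)⟩
  -- The derivative bound holds only while the conjugate stays in `V`, so a first exit time `t₀`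
  -- along the ray to `y` is considered. Before `t₀` the bound keeps the chart value within `L₀ * r
  -- ≤ R / 2`; by closedness this persists at `t₀`, which is therefore no exit.
  have hray : ∀ y ∈ Metric.ball (0 : E) r, g * κ.symm y * g⁻¹ ∈ V := by
    intro y hy
    have hty : ∀ t ∈ Set.Icc (0 : ℝ) 1, t • y ∈ Metric.ball (0 : E) r := fun t ht => by
      rw [mem_ball_zero_iff] at hy ⊢
      rw [norm_smul, Real.norm_of_nonneg ht.1]
      exact (mul_le_of_le_one_left (norm_nonneg _) ht.2).trans_lt hy
    set γ : ℝ → U := fun t => g * κ.symm (t • y) * g⁻¹ with hγ_def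
    have hγ : ContinuousOn γ (Set.Icc 0 1) := by
      refine (continuousOn_const.mul ?_).mul continuousOn_const
      exact κ.symm.continuousOn.comp (by fun_prop) (fun t ht => hball (hty t ht))
    by_contra hbad
    have hcomp : IsCompact (Set.Icc (0 : ℝ) 1 ∩ γ ⁻¹' Vᶜ) :=
      isCompact_Icc.of_isClosed_subset
        (hγ.preimage_isClosed_of_isClosed isClosed_Icc hVo.isClosed_compl) Set.inter_subset_left
    obtain ⟨t₀, ⟨ht₀, ht₀V⟩, hmin⟩ := hcomp.exists_isLeast
      ⟨1, Set.right_mem_Icc.2 zero_le_one, by simpa [hγ_def] using hbad⟩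
    have hlt : ∀ t ∈ Set.Ico 0 t₀, γ t ∈ V := fun t ht => by
      by_contra h
      exact absurd (hmin ⟨⟨ht.1, ht.2.le.trans ht₀.2⟩, h⟩) (not_le.2 ht.2)
    have hIco : Set.Ico 0 t₀ ⊆ Set.Icc (0 : ℝ) 1 := fun t ht => ⟨ht.1, ht.2.le.trans ht₀.2⟩
    have ht₀0 : 0 ≠ t₀ := fun h => ht₀V <| by
      simp [← h, hγ_def, hκ.symm_zero, hV_def, hκ.one_mem, hκ.map_one, hRpos]
    have hcl : t₀ ∈ closure (Set.Ico 0 t₀) := by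
      rw [closure_Ico ht₀0]; exact ⟨ht₀.1, le_rfl⟩
    have hγt₀ : ContinuousWithinAt γ (Set.Ico 0 t₀) t₀ := (hγ t₀ ht₀).mono hIco
    have hsrc : γ t₀ ∈ κ.source := by
      have h := hγt₀.mem_closure hcl (fun t ht => show γ t ∈ N by
        rw [← κ.left_inv (hlt t ht).1]
        exact (hR _ (Metric.ball_subset_ball (min_le_left _ _) (hlt t ht).2)).2)
      rw [hNc.closure_eq] at h
      exact hNs h
    have hbd : ∀ t ∈ Set.Ico 0 t₀, κ (γ t) ∈ Metric.closedBall 0 (R / 2) := fun t ht => by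
      have hconv : Convex ℝ ((fun τ : ℝ => τ • y) '' Set.Ico 0 t₀) :=
        (convex_Ico 0 t₀).is_linear_image (IsLinearMap.isLinearMap_smul' y)
      have := Convex.norm_image_sub_le_of_norm_hasFDerivWithin_le (𝕜 := 𝕜) (f := c)
        (f' := fun x => P (c x) ∘L D ∘L Q x) (C := L₀) (x := 0) (y := t • y)
        (s := (fun τ : ℝ => τ • y) '' Set.Ico 0 t₀)
        (by rintro _ ⟨τ, hτ, rfl⟩
            exact (hder _ (hty τ (hIco hτ)) (hlt τ hτ)).1.hasFDerivWithinAt)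
        (by rintro _ ⟨τ, hτ, rfl⟩
            exact (hder _ (hty τ (hIco hτ)) (hlt τ hτ)).2) hconv
        ⟨0, ⟨le_rfl, lt_of_le_of_ne ht₀.1 ht₀0⟩, zero_smul _ _⟩ ⟨t, ht, rfl⟩
      rw [hc0, sub_zero, sub_zero] at this
      rw [mem_closedBall_zero_iff]
      refine this.trans (le_trans ?_ hLr)
      gcongr
      exact (mem_ball_zero_iff.1 (hty t (hIco ht))).le
    have hκγ := ((κ.continuousAt hsrc).comp_continuousWithinAt hγt₀).mem_closure hcl hbd
    rw [Metric.isClosed_closedBall.closure_eq] at hκγ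
    exact ht₀V ⟨hsrc, Metric.closedBall_subset_ball (by linarith) hκγ⟩
  have hLip : ∀ x ∈ Metric.ball (0 : E) r, ∀ y ∈ Metric.ball (0 : E) r,
      ‖c y - c x‖ ≤ L₀ * ‖y - x‖ := fun x hx y hy =>
    Convex.norm_image_sub_le_of_norm_hasFDerivWithin_le (𝕜 := 𝕜)
      (fun z hz => (hder z hz (hray z hz)).1.hasFDerivWithinAt)
      (fun z hz => (hder z hz (hray z hz)).2) (convex_ball 0 r) hx hy
  refine ⟨fun y hy => (hray y hy).1, fun y hy => ?_, ?_⟩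
  · have := hLip 0 (Metric.mem_ball_self hr) y hy
    rw [hc0, sub_zero, sub_zero] at this
    refine this.trans ?_
    gcongr
    nlinarith
  · refine quadApprox_of_hasFDerivAt (fun x hx => (hder x hx (hray x hx)).1)
      (fun x hx => (hder x hx (hray x hx)).2.trans (by nlinarith)) (fun x hx y hy => ?_)
    have e : P (c y) ∘L D ∘L Q y - P (c x) ∘L D ∘L Q x =
        (P (c y) - P (c x)) ∘L D ∘L Q y + P (c x) ∘L D ∘L (Q y - Q x) := by
      simp only [ContinuousLinearMap.comp_sub, ContinuousLinearMap.sub_comp]; abel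
    have b1 : ‖P (c y) - P (c x)‖ ≤ C₁ * (L₀ * ‖y - x‖) :=
      (hPL _ (hray x hx).2 _ (hray y hy).2).trans (by gcongr; exact hLip x hx y hy)
    rw [e]
    calc _ ≤ C₁ * (L₀ * ‖y - x‖) * (A * C₂) + C₁ * (A * (C₂ * ‖y - x‖)) :=
          (norm_add_le _ _).trans (add_le_add
            (triple _ _ _ _ _ _ (by positivity) hA b1 hDA (hQ y hy))
            (triple _ _ _ _ _ _ hC₁ hA (hP _ (hray x hx).2) hDA (hQL x hx y hy)))
      _ = _ := by rw [hL₀_def]; ring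

end Conj

/-! ### A local slice for the cosets of `G`. -/

section Slice

variable {𝕜 : Type*} [RCLike 𝕜] {E : Type*} [NormedAddCommGroup E] [NormedSpace 𝕜 E]
  {U : Type*} [Group U] [TopologicalSpace U] {κ : OpenPartialHomeomorph U E}

/-- Multiplication by `1` on either side is the identity, which determines the derivative on each
factor. -/
theorem IsIdentityChart.hasFDerivAt_mul (hκ : IsIdentityChart 𝕜 κ) :
    HasFDerivAt (fun p : E × E => κ (κ.symm p.1 * κ.symm p.2))
      (ContinuousLinearMap.fst 𝕜 E E + ContinuousLinearMap.snd 𝕜 E E) (0, 0) := by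
  have hT := (hκ.mul.differentiableAt (by simp)).hasFDerivAt
  set T := fderiv 𝕜 (fun p : E × E => κ (κ.symm p.1 * κ.symm p.2)) (0, 0)
  have ht : ∀ᶠ y in 𝓝 (0 : E), y ∈ κ.target := κ.open_target.mem_nhds hκ.zero_mem
  have h1 : T ∘L ContinuousLinearMap.inl 𝕜 E E = ContinuousLinearMap.id 𝕜 E := by
    refine (HasFDerivAt.comp (f := fun e : E => (e, (0 : E))) (0 : E) hT (hasFDerivAt_prodMk_left (0 : E) (0 : E))).unique
      ((hasFDerivAt_id (𝕜 := 𝕜) (0 : E)).congr_of_eventuallyEq ?_)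
    filter_upwards [ht] with y hy
    simp [hκ.symm_zero, κ.right_inv hy]
  have h2 : T ∘L ContinuousLinearMap.inr 𝕜 E E = ContinuousLinearMap.id 𝕜 E := by
    refine (HasFDerivAt.comp (0 : E) hT (hasFDerivAt_prodMk_right (0 : E) (0 : E))).unique
      ((hasFDerivAt_id (𝕜 := 𝕜) (0 : E)).congr_of_eventuallyEq ?_)
    filter_upwards [ht] with y hy
    simp [hκ.symm_zero, κ.right_inv hy]
  refine hT.congr_fderiv ?_
  ext p
  · simpa using DFunLike.congr_fun h1 p
  · simpa using DFunLike.congr_fun h2 p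

/-- A slice for the right translation action of a split Lie subgroup `G`: near the identity,
`κ⁻¹ ∘ q ∘ κ` picks a representative modulo `G`, in the range of the projection `π`. -/
theorem IsIdentityChart.exists_slice [IsTopologicalGroup U] [CompleteSpace E]
    (hκ : IsIdentityChart 𝕜 κ) {π : E →L[𝕜] E}
    (hπ : ∀ v, π (π v) = π v) {G : Subgroup U} (hG : ∀ x ∈ κ.source, x ∈ G ↔ π (κ x) = 0) :
    ∃ q : E → E, ContDiffAt 𝕜 2 q 0 ∧ q 0 = 0 ∧ (∀ v, π (q v) = q v) ∧
      (∀ᶠ x in 𝓝 (1 : U), (κ.symm (q (κ x)))⁻¹ * x ∈ G) ∧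
      ∃ ρ > 0, ∀ v ∈ Metric.ball (0 : E) ρ, ∀ w ∈ Metric.ball (0 : E) ρ, π v = v → π w = w →
        (κ.symm v)⁻¹ * κ.symm w ∈ G → v = w := by
  set m := fun p : E × E => κ (κ.symm p.1 * κ.symm p.2) with hm_def
  -- `Θ` multiplies a factor from the range of `π` by a factor from its kernel, the latter lying in
  -- `G`. Its derivative at `0` is `π + (id - π) = id`, so it has a local inverse `Ξ`, and `q = π ∘
  -- Ξ` extracts the first factor.
  set Θ : E → E := fun w => m (π w, w - π w) with hΘ_def
  have hs0 := hκ.symm_zero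
  have hΘ0 : Θ 0 = 0 := by simp [hΘ_def, hm_def, hs0, hκ.map_one]
  have hΘc : ContDiffAt 𝕜 2 Θ 0 := by
    refine ContDiffAt.comp (g := m) (f := fun w => (π w, w - π w)) (0 : E) ?_ ?_
    · simpa using hκ.mul
    · exact (π.contDiff.prodMk (contDiff_id.sub π.contDiff)).contDiffAt
  have hΘd : HasFDerivAt Θ ((ContinuousLinearEquiv.refl 𝕜 E : E ≃L[𝕜] E) : E →L[𝕜] E) 0 := by
    have h := HasFDerivAt.comp (0 : E) (g := m) (f := fun w => (π w, w - π w))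
      (by simpa using hκ.hasFDerivAt_mul)
      (π.hasFDerivAt.prodMk ((hasFDerivAt_id (0 : E)).sub π.hasFDerivAt))
    refine HasFDerivAt.congr_fderiv h ?_
    ext v
    simp
  have h2 : (2 : ℕ∞ω) ≠ 0 := by simp
  set Ξ := hΘc.localInverse hΘd h2 with hΞ_def
  have hΞc : ContDiffAt 𝕜 2 Ξ 0 := by
    have := hΘc.to_localInverse hΘd h2
    rwa [hΘ0] at this
  have hstrict := hΘc.hasStrictFDerivAt' hΘd h2
  have hright : ∀ᶠ y in 𝓝 (0 : E), Θ (Ξ y) = y := by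
    have := hstrict.eventually_right_inverse
    rwa [hΘ0] at this
  have hleft : ∀ᶠ y in 𝓝 (0 : E), Ξ (Θ y) = y := hstrict.eventually_left_inverse
  have hΞ0 : Ξ 0 = 0 := by
    have := hleft.self_of_nhds
    rwa [hΘ0] at this
  have hsymm := hκ.continuousAt_symm
  have hsrc : κ.source ∈ 𝓝 (1 : U) := κ.open_source.mem_nhds hκ.one_mem
  have htgt : κ.target ∈ 𝓝 (0 : E) := κ.open_target.mem_nhds hκ.zero_mem
  refine ⟨fun y => π (Ξ y), π.contDiff.contDiffAt.comp 0 hΞc, by simp [hΞ0], fun v => hπ _,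
    ?_, ?_⟩
  · have hκ1 : Filter.Tendsto κ (𝓝 1) (𝓝 0) := by
      simpa [ContinuousAt, hκ.map_one] using κ.continuousAt hκ.one_mem
    have hΞt : Filter.Tendsto Ξ (𝓝 0) (𝓝 0) := by
      simpa [ContinuousAt, hΞ0] using hΞc.continuousAt
    have hπ1 : Filter.Tendsto (fun w => π w) (𝓝 0) (𝓝 0) := by
      simpa [ContinuousAt] using π.continuous.continuousAt (x := 0)
    have hπ2 : Filter.Tendsto (fun w => w - π w) (𝓝 0) (𝓝 0) := by
      simpa using Filter.tendsto_id.sub hπ1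
    have hsy : Filter.Tendsto κ.symm (𝓝 0) (𝓝 1) := by
      simpa [ContinuousAt, hs0] using hsymm
    have hprod : Filter.Tendsto (fun w => κ.symm (π w) * κ.symm (w - π w)) (𝓝 0) (𝓝 1) := by
      simpa using (hsy.comp hπ1).mul (hsy.comp hπ2)
    filter_upwards [hκ1.eventually hright, hsrc, hκ1.eventually (hΞt.eventually (hπ2.eventually htgt)),
      hκ1.eventually (hΞt.eventually (hprod.eventually hsrc))] with x h1 h2 h3 h4
    set w := Ξ (κ x)
    have h5 : κ.symm (π w) * κ.symm (w - π w) = x := by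
      rw [← κ.left_inv h4, ← κ.left_inv h2, ← h1]
    have h6 : (κ.symm (π w))⁻¹ * x = κ.symm (w - π w) := by rw [← h5]; group
    rw [h6, hG _ (κ.map_target h3), κ.right_inv h3]
    simp [hπ]
  · have hn : Filter.Tendsto (fun p : E × E => (κ.symm p.1)⁻¹ * κ.symm p.2) (𝓝 (0, 0)) (𝓝 1) := by
      have hf : Filter.Tendsto (fun p : E × E => κ.symm p.1) (𝓝 (0, 0)) (𝓝 1) := by
        rw [← hs0]; exact hsymm.tendsto.comp continuousAt_fst.tendsto
      have hs : Filter.Tendsto (fun p : E × E => κ.symm p.2) (𝓝 (0, 0)) (𝓝 1) := by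
        rw [← hs0]; exact hsymm.tendsto.comp continuousAt_snd.tendsto
      simpa using hf.inv.mul hs
    have hκn : Filter.Tendsto (fun p : E × E => p.1 + κ ((κ.symm p.1)⁻¹ * κ.symm p.2)) (𝓝 (0, 0))
        (𝓝 0) := by
      have := (κ.continuousAt hκ.one_mem).tendsto.comp hn
      rw [hκ.map_one] at this
      simpa using (continuousAt_fst (p := ((0 : E), (0 : E)))).tendsto.add this
    have e1 : ∀ᶠ p : E × E in 𝓝 (0, 0), p.2 ∈ κ.target ∧ Ξ (Θ p.2) = p.2 :=
      (continuousAt_snd (p := ((0 : E), (0 : E)))).eventually (Filter.Eventually.and htgt hleft)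
    obtain ⟨ρ, hρ, h⟩ := Metric.eventually_nhds_iff_ball.1
      (e1.and ((hn.eventually hsrc).and (hκn.eventually hleft)))
    refine ⟨ρ, hρ, fun v hv w hw hπv hπw hvw => ?_⟩
    obtain ⟨⟨h1, h2⟩, h3, h4⟩ := h (v, w) (by rw [← ball_prod_same]; exact ⟨hv, hw⟩)
    dsimp only at h1 h2 h3 h4
    -- Here `f` lies in the kernel of `π`, so both `v + f` and `w` are mapped to `w` by `Θ`. Local
    -- injectivity gives `v + f = w`, and applying `π` gives `v = w`.
    set f := κ ((κ.symm v)⁻¹ * κ.symm w)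
    have hf : π f = 0 := (hG _ h3).1 hvw
    have hΘf : Θ (v + f) = w := by
      simp only [hΘ_def, hm_def, map_add, hπv, hf, add_zero, add_sub_cancel_left]
      rw [κ.left_inv h3, mul_inv_cancel_left, κ.right_inv h1]
    have hΘw : Θ w = w := by
      simp only [hΘ_def, hm_def, hπw, sub_self, hs0, mul_one, κ.right_inv h1]
    have hvf : v + f = w := by
      rw [hΘf] at h4
      rw [hΘw] at h2
      exact h4.symm.trans h2
    rw [← hπv, ← hπw, ← hvf, map_add, hf, add_zero]

end Slice

/-! ### Fixed points of approximately affine actions of compact groups. -/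

section FixedPoint

open MeasureTheory

variable {𝕜 : Type*} [RCLike 𝕜] {X : Type*} [NormedAddCommGroup X] [NormedSpace 𝕜 X]
  [CompleteSpace X]

/-- Averaging the orbit of a point under a uniformly quadratically approximated local action of a
compact group makes the displacement quadratically smaller. -/
theorem exists_displacement_le {K : Type*} [Group K] [TopologicalSpace K] [IsTopologicalGroup K]
    [CompactSpace K] [T2Space K] {α : K → X → X} {ρ C : ℝ} (hC : 0 ≤ C)
    (hα : ∀ s, QuadApprox 𝕜 (α s) (Metric.ball 0 ρ) C)
    (hmul : ∀ s t, ∀ v ∈ Metric.ball (0 : X) ρ, α t v ∈ Metric.ball (0 : X) ρ →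
      α s (α t v) = α (s * t) v)
    (hcont : ∀ v ∈ Metric.ball (0 : X) ρ, Continuous fun s => α s v)
    {p : X} {η : ℝ} (hη : ∀ s, ‖α s p - p‖ ≤ η) (hp : ‖p‖ + η < ρ) :
    ∃ p' : X, ‖p' - p‖ ≤ η ∧ ∀ s, ‖α s p' - p'‖ ≤ 4 * C * η ^ 2 := by
  let _ : NormedSpace ℝ X := NormedSpace.restrictScalars ℝ 𝕜 X
  let _ : MeasurableSpace K := borel K
  have _ : BorelSpace K := ⟨rfl⟩
  have hη0 : 0 ≤ η := (norm_nonneg _).trans (hη 1)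
  set μ : Measure K := Measure.haarMeasure ⊤
  have hμ : IsProbabilityMeasure μ := ⟨by
    have := Measure.haarMeasure_self (K₀ := (⊤ : TopologicalSpace.PositiveCompacts K))
    simpa using this⟩
  have hpρ : p ∈ Metric.ball (0 : X) ρ := by rw [mem_ball_zero_iff]; linarith
  have hint : ∀ {f : K → X}, Continuous f → Integrable f μ := fun hf =>
    hf.integrable_of_hasCompactSupport (HasCompactSupport.of_compactSpace _)
  have hmem : ∀ v, ‖v - p‖ ≤ η → v ∈ Metric.ball (0 : X) ρ := fun v hv => by
    rw [mem_ball_zero_iff]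
    have := norm_add_le (v - p) p
    rw [sub_add_cancel] at this
    linarith
  have hcp := hcont p hpρ
  have hmean : ∀ (f : K → X) (a : X) (b : ℝ), Continuous f → (∀ t, ‖f t - a‖ ≤ b) →
      ‖∫ t, f t ∂μ - a‖ ≤ b := fun f a b hf hb => by
    have h1 : ∫ t, f t ∂μ - a = ∫ t, (f t - a) ∂μ := by
      rw [integral_sub (hint hf) (integrable_const a)]; simp
    rw [h1]
    simpa using norm_integral_le_of_norm_le_const (μ := μ) (Filter.Eventually.of_forall hb)
  set p' := ∫ t, α t p ∂μ with hp'
  have hp'p : ‖p' - p‖ ≤ η := hmean _ _ _ hcp hη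
  have hp'ρ := hmem p' hp'p
  refine ⟨p', hp'p, fun s => ?_⟩
  obtain ⟨D, -, hD⟩ := hα s p' hp'ρ
  have hdist : ∀ t, ‖α t p - p'‖ ≤ 2 * η := fun t => by
    calc ‖α t p - p'‖ = ‖(α t p - p) - (p' - p)‖ := by congr 1; abel
      _ ≤ η + η := (norm_sub_le _ _).trans (add_le_add (hη t) hp'p)
      _ = 2 * η := by ring
  have hst : Continuous fun t => α (s * t) p := hcp.comp (continuous_const_mul s)
  have hi : Continuous fun t => α t p - p' := hcp.sub continuous_const
  have hDi : Continuous fun t => D (α t p - p') := D.continuous.comp hi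
  -- Invariance of Haar measure makes the first term average to `p'`, and the linear term averages
  -- to zero because `p'` is the mean of the orbit. Hence `α s p' - p'` is, up to sign, a mean of
  -- quadratic errors, each at most `C * (2 * η) ^ 2`.
  have h1 : ∫ t, (α (s * t) p - D (α t p - p')) ∂μ = p' := by
    rw [integral_sub (hint hst) (hint hDi),
      integral_mul_left_eq_self (fun t => α t p) s,
      D.integral_comp_comm (hint hi),
      integral_sub (hint hcp) (integrable_const _)]
    simp [← hp']
  have h2 := hmean (fun t => α (s * t) p - D (α t p - p')) (α s p') (C * (2 * η) ^ 2)
    (hst.sub hDi) (fun t => by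
      have h3 := hD (α t p) (hmem _ (hη t))
      rw [hmul s t p hpρ (hmem _ (hη t))] at h3
      have h4 : α (s * t) p - D (α t p - p') - α s p' =
        α (s * t) p - α s p' - D (α t p - p') := by abel
      rw [h4]
      refine h3.trans ?_
      gcongr
      exact hdist t)
  rw [h1, norm_sub_rev] at h2
  exact h2.trans_eq (by ring)

/-- A uniformly quadratically approximated local action of a compact group which moves the origin
only little has a fixed point close to the origin. -/
theorem exists_fixed_point {K : Type*} [Group K] [TopologicalSpace K] [IsTopologicalGroup K]
    [CompactSpace K] [T2Space K] {α : K → X → X} {ρ C δ : ℝ} (hC : 0 ≤ C)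
    (hα : ∀ s, QuadApprox 𝕜 (α s) (Metric.ball 0 ρ) C)
    (hmul : ∀ s t, ∀ v ∈ Metric.ball (0 : X) ρ, α t v ∈ Metric.ball (0 : X) ρ →
      α s (α t v) = α (s * t) v)
    (hcont : ∀ v ∈ Metric.ball (0 : X) ρ, Continuous fun s => α s v)
    (hδ : ∀ s, ‖α s 0‖ ≤ δ) (hδρ : 3 * δ < ρ) (hδC : 8 * C * δ ≤ 1) :
    ∃ v : X, ‖v‖ ≤ 2 * δ ∧ ∀ s, α s v = v := by
  have hδ0 : 0 ≤ δ := (norm_nonneg _).trans (hδ 1)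
  -- Since `8 * C * δ ≤ 1`, the bound `4 * C * η ^ 2` is at most `η / 2` for `η ≤ δ`: displacements
  -- halve, and the steps sum to at most `2 * δ`.
  let I := fun (n : ℕ) (p : X) => ‖p‖ ≤ 2 * δ * (1 - (1 / 2) ^ n) ∧
    ∀ s, ‖α s p - p‖ ≤ δ * (1 / 2) ^ n
  have hpow : ∀ n : ℕ, 0 < (1 / 2 : ℝ) ^ n ∧ (1 / 2 : ℝ) ^ n ≤ 1 := fun n =>
    ⟨by positivity, pow_le_one₀ (by norm_num) (by norm_num)⟩
  have hstep : ∀ n p, ∃ p', I n p → I (n + 1) p' ∧ ‖p' - p‖ ≤ δ * (1 / 2) ^ n := fun n p => by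
    by_cases h : I n p
    · obtain ⟨ha, hb⟩ := hpow n
      obtain ⟨p', h1, h2⟩ := exists_displacement_le hC hα hmul hcont h.2 (by
        have := h.1; nlinarith)
      refine ⟨p', fun _ => ⟨⟨?_, fun s => (h2 s).trans ?_⟩, h1⟩⟩
      · have := norm_add_le (p' - p) p
        rw [sub_add_cancel] at this
        rw [pow_succ]
        linarith [h.1]
      · have hx : 0 ≤ δ * (1 / 2) ^ n := by positivity
        calc 4 * C * (δ * (1 / 2) ^ n) ^ 2
            = (8 * C * δ) * ((1 / 2) ^ n * (δ * (1 / 2) ^ n)) / 2 := by ring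
          _ ≤ 1 * (1 * (δ * (1 / 2) ^ n)) / 2 := by gcongr
          _ = δ * (1 / 2) ^ (n + 1) := by rw [pow_succ]; ring
    · exact ⟨0, fun h' => absurd h' h⟩
  choose N hN using hstep
  let p : ℕ → X := fun n => Nat.rec 0 (fun k x => N k x) n
  have hp : ∀ n, I n (p n) := fun n => by
    induction n with
    | zero => exact ⟨by simp [p], fun s => by simpa [p] using hδ s⟩
    | succ k ih => exact (hN k (p k) ih).1
  have hcauchy : CauchySeq p := cauchySeq_of_le_geometric (1 / 2) δ (by norm_num) fun n => by
    rw [dist_comm, dist_eq_norm]; exact (hN n (p n) (hp n)).2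
  obtain ⟨v, hv⟩ := cauchySeq_tendsto_of_complete hcauchy
  have hpn : ∀ n, ‖p n‖ ≤ 2 * δ := fun n => (hp n).1.trans (by
    have := hpow n; nlinarith)
  have hvn : ‖v‖ ≤ 2 * δ := le_of_tendsto hv.norm (Filter.Eventually.of_forall hpn)
  have hball : ∀ w : X, ‖w‖ ≤ 2 * δ → w ∈ Metric.ball (0 : X) ρ := fun w hw => by
    rw [mem_ball_zero_iff]; linarith
  refine ⟨v, hvn, fun s => ?_⟩
  have hpv : Filter.Tendsto (fun n => ‖p n - v‖) Filter.atTop (𝓝 0) := by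
    simpa using (hv.sub_const v).norm
  have h1 : Filter.Tendsto (fun n => α s (p n) - α s v) Filter.atTop (𝓝 0) := by
    refine squeeze_zero_norm (fun n => (hα s).norm_sub_le (hball v hvn) (hball _ (hpn n))) ?_
    simpa using ((hpv.const_add 1).const_mul C).mul hpv
  have h2 : Filter.Tendsto (fun n => α s (p n) - p n) Filter.atTop (𝓝 0) := by
    refine squeeze_zero_norm (fun n => (hp n).2 s) ?_
    simpa using (tendsto_pow_atTop_nhds_zero_of_lt_one (r := (1 / 2 : ℝ)) (by norm_num)
      (by norm_num)).const_mul δ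
  have h3 : Filter.Tendsto (fun n => α s (p n) - p n) Filter.atTop (𝓝 (α s v - v)) := by
    have := (h1.add_const (α s v)).sub hv
    simpa using this
  exact sub_eq_zero.1 (tendsto_nhds_unique h3 h2)

end FixedPoint

/-- Adjoins the frozen coordinate `κ (u h)` of the local action without changing the constant. -/
theorem QuadApprox.prodMk_const {𝕜 : Type*} [RCLike 𝕜] {X Y Z : Type*} [NormedAddCommGroup X]
    [NormedSpace 𝕜 X] [NormedAddCommGroup Y] [NormedSpace 𝕜 Y] [NormedAddCommGroup Z]
    [NormedSpace 𝕜 Z] {f : X → Y} {B : Set X} {C : ℝ} (h : QuadApprox 𝕜 f B C) (z : Z) :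
    QuadApprox 𝕜 (fun x => (f x, z)) B C := by
  intro v hv
  obtain ⟨D, hD, h⟩ := h v hv
  refine ⟨ContinuousLinearMap.inl 𝕜 Y Z ∘L D, ?_, fun y hy => ?_⟩
  · exact (ContinuousLinearMap.opNorm_comp_le _ _).trans
      ((mul_le_of_le_one_left (norm_nonneg _)
        (ContinuousLinearMap.norm_inl_le_one 𝕜 Y Z)).trans hD)
  · simpa [Prod.norm_def] using h y hy

/-! ### Conjugating a compact subgroup into `G`. -/

section Conjugate

variable {𝕜 : Type*} [RCLike 𝕜] {E : Type*} [NormedAddCommGroup E] [NormedSpace 𝕜 E]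
  {U : Type*} [Group U] [TopologicalSpace U]
  {κ : OpenPartialHomeomorph U E}

theorem IsIdentityChart.tendsto_symm (hκ : IsIdentityChart 𝕜 κ) :
    Filter.Tendsto κ.symm (𝓝 0) (𝓝 1) := by
  simpa [ContinuousAt, hκ.symm_zero] using hκ.continuousAt_symm

theorem IsIdentityChart.tendsto (hκ : IsIdentityChart 𝕜 κ) : Filter.Tendsto κ (𝓝 1) (𝓝 0) := by
  simpa [ContinuousAt, hκ.map_one] using κ.continuousAt hκ.one_mem

variable [IsTopologicalGroup U]

/-- Conjugations with uniformly bounded derivative at the identity are equicontinuous there. -/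
theorem IsIdentityChart.eventually_conj_mem (hκ : IsIdentityChart 𝕜 κ) {A : ℝ} (hA : 0 ≤ A)
    {V : Set U} (hV : V ∈ 𝓝 1) :
    ∀ᶠ x in 𝓝 (1 : U), ∀ g : U, (∃ D : E →L[𝕜] E, ‖D‖ ≤ A ∧
      HasFDerivAt (fun y : E => κ (g * κ.symm y * g⁻¹)) D 0) → g * x * g⁻¹ ∈ V := by
  obtain ⟨r, hr, L, hL, -, h⟩ := hκ.exists_conj_quadApprox hA
  obtain ⟨η, hη, hηV⟩ := Metric.eventually_nhds_iff_ball.1 (hκ.tendsto_symm.eventually hV)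
  have h1 : ∀ᶠ y in 𝓝 (0 : E), y ∈ Metric.ball (0 : E) (min r (η / (L + 1))) :=
    Metric.ball_mem_nhds _ (by positivity)
  filter_upwards [κ.open_source.mem_nhds hκ.one_mem, hκ.tendsto.eventually h1] with x hx hxr
  rintro g ⟨D, hDA, hD⟩
  obtain ⟨hs, hb, -⟩ := h g D hDA hD
  have hxr' := Metric.ball_subset_ball (min_le_left _ _) hxr
  have hs := hs _ hxr'
  have hb := hb _ hxr'
  rw [κ.left_inv hx] at hs hb
  rw [← κ.left_inv hs]
  refine hηV _ (mem_ball_zero_iff.2 (hb.trans_lt ?_))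
  have h2 := mem_ball_zero_iff.1 (Metric.ball_subset_ball (min_le_right _ _) hxr)
  rw [lt_div_iff₀ (by positivity)] at h2
  nlinarith [norm_nonneg (κ x)]

/-- A compact subgroup which is close to a split Lie subgroup `G`, and whose conjugations are
uniformly bounded on the Lie algebra, can be conjugated into `G` by an element close to `1`. -/
theorem IsIdentityChart.exists_conj_mem [T2Space U] [CompleteSpace E] (hκ : IsIdentityChart 𝕜 κ)
    {π : E →L[𝕜] E} (hπ : ∀ v, π (π v) = π v) {G : Subgroup U}
    (hG : ∀ x ∈ κ.source, x ∈ G ↔ π (κ x) = 0) {A : ℝ} (hA : 0 ≤ A) {V : Set U} (hV : V ∈ 𝓝 1) :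
    ∃ U₀ ∈ 𝓝 (1 : U), ∀ H : Subgroup U, IsCompact (H : Set U) → (H : Set U) ⊆ G * U₀ →
      (∀ g ∈ H, ∃ D : E →L[𝕜] E, ‖D‖ ≤ A ∧
        HasFDerivAt (fun y : E => κ (g * κ.symm y * g⁻¹)) D 0) →
      ∃ x ∈ V, ∀ g ∈ H, x⁻¹ * g * x ∈ G := by
  obtain ⟨q, hqc, hq0, hπq, hqG, ρ₀, hρ₀, huniq⟩ := hκ.exists_slice hπ hG
  obtain ⟨r, hr, L, hL, hball, hconj⟩ := hκ.exists_conj_quadApprox hA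
  have hs := hκ.tendsto_symm
  have htgt : κ.target ∈ 𝓝 (0 : E) := κ.open_target.mem_nhds hκ.zero_mem
  have hsrc : κ.source ∈ 𝓝 (1 : U) := κ.open_source.mem_nhds hκ.one_mem
  have hq_tendsto : Filter.Tendsto q (𝓝 0) (𝓝 0) := by
    simpa [ContinuousAt, hq0] using hqc.continuousAt
  obtain ⟨ρ₂', hρ₂', hρ₂⟩ := Metric.eventually_nhds_iff_ball.1 (Filter.Eventually.and htgt
    ((hqc.eventually (by simp)).and ((hq_tendsto.eventually (Metric.ball_mem_nhds 0 hρ₀)).and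
      (hs.eventually hqG.eventually_nhds))))
  set ρ₂ := min ρ₀ ρ₂' with hρ₂_def
  have hρ₂pos : 0 < ρ₂ := lt_min hρ₀ hρ₂'
  set f := fun p : E × E => q (κ (κ.symm p.1 * κ.symm p.2)) with hf_def
  have hf0 : f (0, 0) = 0 := by simp [hf_def, hκ.symm_zero, hκ.map_one, hq0]
  have hfc : ContDiffAt 𝕜 2 f (0, 0) := by
    refine ContDiffAt.comp (g := q) (0, 0) ?_ hκ.mul
    simpa [hκ.symm_zero, hκ.map_one] using hqc
  have hf_tendsto : Filter.Tendsto f (𝓝 (0, 0)) (𝓝 0) := by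
    simpa [ContinuousAt, hf0] using hfc.continuousAt
  obtain ⟨r_f, hr_f, C_f, hC_f, hfq⟩ := exists_quadApprox_of_contDiffAt hfc
  have hmul_tendsto : Filter.Tendsto (fun p : E × E => κ.symm p.1 * κ.symm p.2) (𝓝 (0, 0))
      (𝓝 1) := by
    have h1 : Filter.Tendsto (fun p : E × E => κ.symm p.1) (𝓝 (0, 0)) (𝓝 1) :=
      hs.comp continuousAt_fst.tendsto
    have h2 : Filter.Tendsto (fun p : E × E => κ.symm p.2) (𝓝 (0, 0)) (𝓝 1) :=
      hs.comp continuousAt_snd.tendsto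
    simpa using h1.mul h2
  obtain ⟨ρ₁', hρ₁', hρ₁⟩ := Metric.eventually_nhds_iff_ball.1
    ((hmul_tendsto.eventually hqG).and (hf_tendsto.eventually (Metric.ball_mem_nhds 0 hρ₂pos)))
  set ρ₁ := min r_f ρ₁' with hρ₁_def
  have hρ₁pos : 0 < ρ₁ := lt_min hr_f hρ₁'
  set ρ := min r (ρ₁ / (L + 1)) / (‖π‖ + 1) with hρ_def
  have hρpos : 0 < ρ := by positivity
  have hπρ : ∀ v ∈ Metric.ball (0 : E) ρ, π v ∈ Metric.ball (0 : E) r ∧ L * ‖π v‖ < ρ₁ := by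
    intro v hv
    rw [mem_ball_zero_iff, hρ_def, lt_div_iff₀ (by positivity)] at hv
    have h1 : ‖π v‖ ≤ ‖v‖ * (‖π‖ + 1) := by
      nlinarith [π.le_opNorm v, norm_nonneg v]
    have h2 := lt_of_le_of_lt h1 hv
    have h3 := h2.trans_le (min_le_right _ _)
    rw [lt_div_iff₀ (by positivity)] at h3
    exact ⟨mem_ball_zero_iff.2 (h2.trans_le (min_le_left _ _)),
      by nlinarith [norm_nonneg (π v)]⟩
  set C₁ := L * (‖π‖ * (1 + 2 * ρ)) ^ 2 + L * ‖π‖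
  have hC₁ : 0 ≤ C₁ := by positivity
  set C := C_f * (C₁ * (1 + 2 * ρ)) ^ 2 + C_f * C₁
  have hC : 0 ≤ C := by positivity
  obtain ⟨δ₀, hδ₀, hδV⟩ := Metric.eventually_nhds_iff_ball.1 (hs.eventually hV)
  set δ := min (δ₀ / 3) (min (ρ / 4) (1 / (8 * C + 1))) with hδ_def
  have hδ : 0 < δ := by positivity
  have hδ1 : 2 * δ < δ₀ := by
    have : δ ≤ δ₀ / 3 := min_le_left _ _
    linarith
  have hδ2 : 3 * δ < ρ := by
    have : δ ≤ ρ / 4 := (min_le_right _ _).trans (min_le_left _ _)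
    linarith
  have hδ3 : 8 * C * δ ≤ 1 := by
    have : δ ≤ 1 / (8 * C + 1) := (min_le_right _ _).trans (min_le_right _ _)
    rw [le_div_iff₀ (by positivity)] at this
    linarith
  have hk_tendsto : Filter.Tendsto (fun u : U => κ u⁻¹) (𝓝 1) (𝓝 0) := by
    refine hκ.tendsto.comp ?_
    simpa using (continuous_inv (G := U)).tendsto 1
  have hinv_src : ∀ᶠ u in 𝓝 (1 : U), u⁻¹ ∈ κ.source := by
    have : Filter.Tendsto (fun u : U => u⁻¹) (𝓝 1) (𝓝 1) := by
      simpa using (continuous_inv (G := U)).tendsto 1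
    exact this.eventually hsrc
  have hf_small : ∀ᶠ k in 𝓝 (0 : E), f (0, k) ∈ Metric.ball (0 : E) δ := by
    have : Filter.Tendsto (fun k : E => ((0 : E), k)) (𝓝 0) (𝓝 (0, 0)) :=
      (Continuous.prodMk_right (0 : E)).tendsto 0
    exact (hf_tendsto.comp this).eventually (Metric.ball_mem_nhds 0 hδ)
  refine ⟨_, hinv_src.and ((hk_tendsto.eventually (Metric.ball_mem_nhds 0 hρ₁pos)).and
    (hk_tendsto.eventually hf_small)), fun H hHc hHU hHD => ?_⟩
  -- Applying the hypothesis to `h⁻¹` shows that the coset `hG` has a representative `u` close to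
  -- `1`.
  have hu : ∀ h : H, ∃ u : U, (h : U)⁻¹ * u ∈ G ∧ u ∈ κ.source ∧
      κ u ∈ Metric.ball (0 : E) ρ₁ ∧ f (0, κ u) ∈ Metric.ball (0 : E) δ := by
    intro h
    obtain ⟨g, hg, u, ⟨hu1, hu2, hu3⟩, hgu⟩ := Set.mem_mul.1 (hHU (H.inv_mem h.2))
    refine ⟨u⁻¹, ?_, hu1, hu2, hu3⟩
    rw [← hgu, mul_inv_cancel_right]
    exact hg
  choose u huG hus hu1 huδ using hu
  -- With `x = κ.symm (π v)`, one has `h x G = (h x h⁻¹) (u h) G`. The element `h` may be far from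
  -- `1`, but both factors on the right are near it, so the chart and the slice apply.
  let α : H → E → E := fun h v => f (κ (h * κ.symm (π v) * (h : U)⁻¹), κ (u h))
  have hpair : ∀ (h : H), ∀ v ∈ Metric.ball (0 : E) ρ,
      (κ (h * κ.symm (π v) * (h : U)⁻¹), κ (u h)) ∈ Metric.ball ((0 : E), (0 : E)) ρ₁ := by
    intro h v hv
    obtain ⟨D, hDA, hD⟩ := hHD h h.2
    rw [← ball_prod_same]
    exact ⟨mem_ball_zero_iff.2 (((hconj h D hDA hD).2.1 _ (hπρ v hv).1).trans_lt (hπρ v hv).2),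
      hu1 h⟩
  have hαmem : ∀ (h : H), ∀ v ∈ Metric.ball (0 : E) ρ, α h v ∈ Metric.ball (0 : E) ρ₂ :=
    fun h v hv => (hρ₁ _ (Metric.ball_subset_ball (min_le_right _ _) (hpair h v hv))).2
  have hαπ : ∀ h v, π (α h v) = α h v := fun h v => hπq _
  have hαG : ∀ (h : H), ∀ v ∈ Metric.ball (0 : E) ρ,
      (κ.symm (α h v))⁻¹ * (h * κ.symm (π v)) ∈ G := by
    intro h v hv
    obtain ⟨D, hDA, hD⟩ := hHD h h.2
    have h1 := (hρ₁ _ (Metric.ball_subset_ball (min_le_right _ _) (hpair h v hv))).1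
    have h2 := (hconj h D hDA hD).1 _ (hπρ v hv).1
    have h3 : (κ.symm (α h v))⁻¹ * (h * κ.symm (π v) * (h : U)⁻¹ * u h) ∈ G := by
      simp only [κ.left_inv h2, κ.left_inv (hus h)] at h1
      simpa only [α, hf_def, κ.left_inv h2, κ.left_inv (hus h)] using h1
    have h4 := G.mul_mem h3 (G.inv_mem (huG h))
    convert h4 using 1
    group
  have hsub : Metric.ball (0 : E) ρ₂ ⊆ Metric.ball (0 : E) ρ₀ :=
    Metric.ball_subset_ball (min_le_left _ _)
  have hαquad : ∀ h, QuadApprox 𝕜 (α h) (Metric.ball 0 ρ) C := by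
    intro h
    obtain ⟨D, hDA, hD⟩ := hHD h h.2
    have hdist : ∀ x ∈ Metric.ball (0 : E) ρ, ∀ y ∈ Metric.ball (0 : E) ρ, ‖y - x‖ ≤ 2 * ρ :=
      fun x hx y hy => by
        rw [mem_ball_zero_iff] at hx hy
        linarith [norm_sub_le y x]
    have h1 := QuadApprox.comp (norm_nonneg π) hL (hconj h D hDA hD).2.2
      (ContinuousLinearMap.quadApprox π (Metric.ball 0 ρ)) (fun v hv => (hπρ v hv).1) hdist
    exact QuadApprox.comp hC₁ hC_f (hfq.mono (Metric.ball_subset_ball (min_le_left _ _)) le_rfl)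
      (h1.prodMk_const (κ (u h))) (hpair h) hdist
  have hαmul : ∀ s t, ∀ v ∈ Metric.ball (0 : E) ρ, α t v ∈ Metric.ball (0 : E) ρ →
      α s (α t v) = α (s * t) v := by
    intro s t v hv htv
    -- Both sides are slice representatives of the coset `s t x G`, with `x = κ.symm (π v)`.
    refine huniq _ (hsub (hαmem s _ htv)) _ (hsub (hαmem (s * t) v hv)) (hαπ _ _) (hαπ _ _) ?_
    have h1 := hαG s _ htv
    have h2 := hαG t v hv
    have h3 := hαG (s * t) v hv
    rw [hαπ] at h1
    convert G.mul_mem (G.mul_mem h1 h2) (G.inv_mem h3) using 1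
    push_cast
    group
  have hαcont : ∀ v ∈ Metric.ball (0 : E) ρ, Continuous fun s => α s v := by
    intro v hv
    -- The choice of `u` need not be continuous. Near `t`, uniqueness of slice representatives
    -- identifies `α s v` with `q (κ (s t⁻¹ κ.symm w))`, which tends to `w` as `s` tends to `t`.
    refine continuous_iff_continuousAt.2 fun t => ?_
    set w := α t v with hw_def
    have hw := hαmem t v hv
    obtain ⟨hw1, hw2, hw3, hw4⟩ := hρ₂ w (Metric.ball_subset_ball (min_le_right _ _) hw)
    have hqw : q w = w := by
      refine huniq _ hw3 _ (hsub hw) (hπq _) (hαπ _ _) ?_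
      have := hw4.self_of_nhds
      rwa [κ.right_inv hw1] at this
    have hz : Filter.Tendsto (fun s : H => (s : U) * (t : U)⁻¹ * κ.symm w) (𝓝 t)
        (𝓝 (κ.symm w)) := by
      have : Continuous fun s : H => (s : U) * (t : U)⁻¹ * κ.symm w := by fun_prop
      simpa using this.tendsto t
    have hqz : Filter.Tendsto (fun s : H => q (κ ((s : U) * (t : U)⁻¹ * κ.symm w))) (𝓝 t)
        (𝓝 w) := by
      have h1 : Filter.Tendsto κ (𝓝 (κ.symm w)) (𝓝 w) := by
        simpa [ContinuousAt, κ.right_inv hw1] using κ.continuousAt (κ.map_target hw1)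
      have h2 : Filter.Tendsto q (𝓝 w) (𝓝 w) := by
        simpa [ContinuousAt, hqw] using hw2.continuousAt
      exact h2.comp (h1.comp hz)
    refine Filter.Tendsto.congr' ?_ hqz
    filter_upwards [hz.eventually hw4, hqz.eventually (Metric.isOpen_ball.mem_nhds (hsub hw))]
      with s hs1 hs2
    refine huniq _ hs2 _ (hsub (hαmem s v hv)) (hπq _) (hαπ _ _) ?_
    have h1 := hαG t v hv
    have h2 := hαG s v hv
    convert G.mul_mem (G.mul_mem hs1 h1) (G.inv_mem h2) using 1
    rw [← hw_def]
    group
  have hα0 : ∀ s, ‖α s 0‖ ≤ δ := by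
    intro s
    have h1 : α s 0 = f (0, κ (u s)) := by simp [α, hκ.symm_zero, hκ.map_one]
    rw [h1]
    exact (mem_ball_zero_iff.1 (huδ s)).le
  have hcomp : CompactSpace H := isCompact_iff_compactSpace.1 hHc
  obtain ⟨v, hv, hfix⟩ := exists_fixed_point hC hαquad hαmul hαcont hα0 hδ2 hδ3
  refine ⟨κ.symm v, hδV v (mem_ball_zero_iff.2 (hv.trans_lt hδ1)), fun g hg => ?_⟩
  -- A fixed point of `α` in the slice means `g x G = x G` for `x = κ.symm v`.
  have h1 := hαG ⟨g, hg⟩ v (mem_ball_zero_iff.2 (by linarith))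
  have h2 := hαπ ⟨g, hg⟩ v
  rw [hfix] at h1 h2
  rw [h2] at h1
  rwa [mul_assoc]

end Conjugate

end BanachLie

/-! ### The main theorem. -/

theorem theorem1p2 {𝕜 : Type*} [RCLike 𝕜]
    {E : Type*} [NormedAddCommGroup E] [NormedSpace 𝕜 E] [CompleteSpace E]
    {U : Type*} [Group U] [MetricSpace U] [ChartedSpace E U] [LieGroup 𝓘(𝕜, E) ω U]
    (hd : (∀ a x y : U, dist (a * x) (a * y) = dist x y) ∨
      (∀ a x y : U, dist (x * a) (y * a) = dist x y))
    (G : Subgroup U) (hG : BanachLie.IsLieSubgroup 𝕜 E G)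
    (S : Set U) (hS : BanachLie.AdBounded 𝕜 E S) (ε : ℝ) (hε : 0 < ε) :
    ∃ U₀ ∈ 𝓝 (1 : U),
      ∀ (K : Type*) [Group K] [TopologicalSpace K] [IsTopologicalGroup K] [CompactSpace K]
        (φ : K →ₜ* U), (∀ s : K, φ s ∈ ((G : Set U) * U₀) ∩ S) →
        ∃ ψ : K →ₜ* G, (∀ s : K, dist (φ s) (ψ s : U) < ε) ∧
          (Topology.IsEmbedding φ → Topology.IsEmbedding ψ) := by
  have _ : IsTopologicalGroup U := topologicalGroup_of_lieGroup 𝓘(𝕜, E) ω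
  obtain ⟨κ, hκ, ⟨π, hπ, hπG⟩, M, hM, hAd⟩ := hG.exists_chart
  obtain ⟨C, hC⟩ := hS
  set A := M * max C 0
  have hA : 0 ≤ A := by positivity
  have hSD : ∀ g ∈ S, ∃ D : E →L[𝕜] E, ‖D‖ ≤ A ∧
      HasFDerivAt (fun y : E => κ (g * κ.symm y * g⁻¹)) D 0 := fun g hg => by
    obtain ⟨D, hD, hder⟩ := hAd g
    exact ⟨D, hD.trans (mul_le_mul_of_nonneg_left ((hC g hg).trans (le_max_left _ _)) hM), hder⟩
  have hdiv : Filter.Tendsto (fun p : U × U => dist 1 (p.1⁻¹ * p.2)) (𝓝 1 ×ˢ 𝓝 1) (𝓝 0) := by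
    have : Continuous fun p : U × U => dist 1 (p.1⁻¹ * p.2) := by fun_prop
    simpa [nhds_prod_eq] using this.tendsto (1, 1)
  obtain ⟨V, hV, hVε⟩ := (Filter.eventually_prod_self_iff
    (r := fun a b : U => dist 1 (a⁻¹ * b) < ε)).1 (hdiv.eventually_lt_const hε)
  obtain ⟨U₀, hU₀, hconj⟩ := hκ.exists_conj_mem hπ hπG hA
    (Filter.inter_mem hV (hκ.eventually_conj_mem hA hV))
  refine ⟨U₀, hU₀, fun K _ _ _ _ φ hφ => ?_⟩
  -- The averaging takes place over the image of `φ`, which is Hausdorff even when `K` is not.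
  obtain ⟨x, ⟨hxV, hx⟩, hxG⟩ := hconj (φ : K →* U).range
    (by simpa using isCompact_range φ.continuous_toFun)
    (by rintro _ ⟨s, rfl⟩; exact (hφ s).1)
    (by rintro _ ⟨s, rfl⟩; exact hSD _ (hφ s).2)
  have hcont : Continuous fun s => x⁻¹ * φ s * x :=
    (continuous_const.mul φ.continuous_toFun).mul continuous_const
  have hmem : ∀ s, x⁻¹ * φ s * x ∈ G := fun s => hxG _ ⟨s, rfl⟩
  let ψ : K →ₜ* G :=
    { toFun := fun s => ⟨x⁻¹ * φ s * x, hmem s⟩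
      map_one' := by ext; simp
      map_mul' := fun s t => by ext; simp [mul_assoc]
      continuous_toFun := hcont.subtype_mk hmem }
  refine ⟨ψ, fun s => ?_, fun hemb => ?_⟩
  · change dist (φ s) (x⁻¹ * φ s * x) < ε
    -- Invariance reduces the distance to that between `1` and `a⁻¹ b`, where one of `a`, `b` is `x`
    -- and the other a conjugate of `x`: by `φ s⁻¹` in the left-invariant case, by `φ s` in the
    -- right-invariant one. Both lie in `V`.
    rcases hd with hd | hd
    · have h := hVε _ (hx (φ s⁻¹) (hSD _ (hφ s⁻¹).2)) _ hxV
      rw [← hd (φ s)] at h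
      convert h using 2 <;> simp [mul_assoc]
    · have h := hVε _ hxV _ (hx (φ s) (hSD _ (hφ s).2))
      rw [← hd (φ s)] at h
      convert h using 2 <;> simp [mul_assoc]
  · have h1 : Topology.IsEmbedding fun s => x⁻¹ * φ s * x :=
      ((Homeomorph.mulLeft x⁻¹).trans (Homeomorph.mulRight x)).isEmbedding.comp hemb
    exact h1.codRestrict (G : Set U) hmem
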